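/- Let $(\mathcal X,d_{\mathcal X})$ and $(\mathcal Y,d_{\mathcal Y})$ be Polish metric spaces of finite diameter, let $\mathcal X\times\mathcal Y$ carry the product metric $\max(d_{\mathcal X},d_{\mathcal Y})$, and let $\mu\in\mathcal P(\mathcal X)$, $\nu\in\mathcal P(\mathcal Y)$ be Borel probability measures. Let $\Pi(\mu,\nu)$ be the set of probability measures on $\mathcal X\times\mathcal Y$ with marginals $\mu$ and $\nu$, let $W_1$ be the $1$-Wasserstein distance on $\mathcal P(\mathcal X\times\mathcal Y)$, and let $H(\cdot\,\|\,\cdot)$ be the relative entropy. Let $R\in\mathcal P(\mathcal X\times\mathcal Y)$ satisfy $R\ll\mu\otimes\nu$ and suppose that $H(\pi\,\|\,R)<\infty$ for at least one $\pi\in\Pi(\mu,\nu)$. Let $F:\mathcal P(\mathcal X\times\mathcal Y)\to[0,\infty)$ be convex, and let $\frac{\delta F}{\delta m}:\mathcal P(\mathcal X\times\mathcal Y)\times(\mathcal X\times\mathcal Y)\to\mathbb R$ be a continuous map (for the topology of weak convergence on $\mathcal P(\mathcal X\times\mathcal Y)$) which is a linear derivative of $F$, that is, for all $\pi,\pi'\in\mathcal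 P(\mathcal X\times\mathcal Y)$, \[ F(\pi)-F(\pi')=\int_0^1\int_{\mathcal X\times\mathcal Y}\tfrac{\delta F}{\delta m}\bigl((1-\eta)\pi'+\eta\pi,x,y\bigr)\,d(\pi-\pi')(x,y)\,d\eta . \] Suppose that the oscillation $\sup\frac{\delta F}{\delta m}(\pi,\cdot)-\inf\frac{\delta F}{\delta m}(\pi,\cdot)$ is bounded uniformly in $\pi\in\mathcal P(\mathcal X\times\mathcal Y)$, and that, for some constant $L>0$, \[ \bigl\|\tfrac{\delta F}{\delta m}(P,\cdot)-\tfrac{\delta F}{\delta m}(Q,\cdot)\bigr\|_{L^\infty(\mu\otimes\nu)}\le L\,W_1(P,Q)\qquad\text{for all }P,Q\in\Pi(\mu,\nu). \] Then for every $P\in\Pi(\mu,\nu)$ the functional \[ \pi\longmapsto\int_{\mathcal X\times\mathcal Y}\tfrac{\delta F}{\delta m}(P,x,y)\,\pi(dx,dy)+H(\pi\,\|\,R) \] has exactly one minimizer over $\Pi(\mu,\nu)$, denoted $T(P)$, and there is a constant $C>0$ such that, for all $P,Q\in\Pi(\mu,\nu)$, \[ W_1\bigl(T(P),T(Q)\bigr)\;\le\;C\,\bigl\|\tfrac{\delta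 F}{\delta m}(P,\cdot)-\tfrac{\delta F}{\delta m}(Q,\cdot)\bigr\|_{L^\infty(\mu\otimes\nu)}\;\le\;C\,L\,W_1(P,Q). \] In particular, the map $T:\Pi(\mu,\nu)\to\Pi(\mu,\nu)$ is Lipschitz for $W_1$. -/

import Mathlib

open MeasureTheory
open scoped ENNReal NNReal unitInterval

noncomputable section

namespace EntropicOT

/-- The set `Π(ρ, η)` of couplings: probability measures on `α × β` whose marginals are `ρ`
and `η`. -/
def couplings {α β : Type*} [MeasurableSpace α] [MeasurableSpace β]
    (ρ : ProbabilityMeasure α) (η : ProbabilityMeasure β) : Set (ProbabilityMeasure (α × β)) :=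
  {γ | (γ : Measure (α × β)).fst = (ρ : Measure α) ∧
       (γ : Measure (α × β)).snd = (η : Measure β)}

/-- The `1`-Wasserstein distance `W₁(ρ, η) = inf_{γ ∈ Π(ρ, η)} ∫ d(z, z') γ(dz, dz')`,
with values in `[0, ∞]` (it is finite on bounded spaces). -/
def W1 {Z : Type*} [MetricSpace Z] [MeasurableSpace Z] (ρ η : ProbabilityMeasure Z) : ℝ≥0∞ :=
  ⨅ γ ∈ couplings ρ η, ∫⁻ p : Z × Z, edist p.1 p.2 ∂(γ : Measure (Z × Z))

/-- The convex combination `(1 - t) P + t Q` of two probability measures, for `t ∈ [0, 1]`. -/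
def mix {Z : Type*} [MeasurableSpace Z] (t : I) (P Q : ProbabilityMeasure Z) :
    ProbabilityMeasure Z :=
  ⟨ENNReal.ofReal (1 - (t : ℝ)) • (P : Measure Z) + ENNReal.ofReal (t : ℝ) • (Q : Measure Z),
    ⟨by
      have h : ENNReal.ofReal (1 - (t : ℝ)) + ENNReal.ofReal (t : ℝ) = 1 := by
        rw [← ENNReal.ofReal_add (sub_nonneg.2 t.2.2) t.2.1, sub_add_cancel, ENNReal.ofReal_one]
      simpa using h⟩⟩

section Derivative

variable {Z : Type*} [TopologicalSpace Z] [MeasurableSpace Z] [OpensMeasurableSpace Z]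

/-- `dF` is a functional linear derivative of `F : 𝓟(Z) → ℝ`: it is jointly continuous on
`𝓟(Z) × Z` (`𝓟(Z)` carrying the topology of weak convergence) and
`F(π) - F(π') = ∫₀¹ ∫ dF(π^η, z) (π - π')(dz) dη` with `π^η = (1 - η) π' + η π`. -/
structure IsLinearDerivative (F : ProbabilityMeasure Z → ℝ)
    (dF : ProbabilityMeasure Z → Z → ℝ) : Prop where
  continuous : Continuous (fun p : ProbabilityMeasure Z × Z => dF p.1 p.2)
  integral_eq : ∀ π π' : ProbabilityMeasure Z,
    F π - F π' = ∫ η : I, ((∫ z, dF (mix η π' π) z ∂(π : Measure Z)) -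
      (∫ z, dF (mix η π' π) z ∂(π' : Measure Z)))

end Derivative

section Problem

variable {X Y : Type*} [MetricSpace X] [PolishSpace X] [MeasurableSpace X] [BorelSpace X]
  [MetricSpace Y] [PolishSpace Y] [MeasurableSpace Y] [BorelSpace Y]

/-- The standing assumptions on the cost functional `F`, on the chosen linear derivative `dF`
of `F`, and on the Lipschitz constant `L` of `P ↦ dF(P, ·)`. -/
structure CostAssumption (μ : ProbabilityMeasure X) (ν : ProbabilityMeasure Y)
    (F : ProbabilityMeasure (X × Y) → ℝ) (dF : ProbabilityMeasure (X × Y) → X × Y → ℝ)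
    (L : ℝ≥0) : Prop where
  /-- `F` is convex. -/
  convex : ∀ (P Q : ProbabilityMeasure (X × Y)) (t : I),
    F (mix t P Q) ≤ (1 - (t : ℝ)) * F P + (t : ℝ) * F Q
  /-- `F` is non-negative. -/
  nonneg : ∀ P, 0 ≤ F P
  /-- `dF` is a continuous linear derivative of `F`. -/
  deriv : IsLinearDerivative F dF
  /-- The oscillation of `dF(P, ·)` is bounded uniformly in `P`. -/
  osc : ∃ Cosc : ℝ, 0 < Cosc ∧
    ∀ (P : ProbabilityMeasure (X × Y)) (z z' : X × Y), dF P z - dF P z' ≤ Cosc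
  /-- The Lipschitz constant is positive. -/
  L_pos : 0 < L
  /-- `P ↦ dF(P, ·)` is `L`-Lipschitz from `(Π(μ, ν), W₁)` to `L^∞(μ ⊗ ν)`. -/
  lipschitz : ∀ P ∈ couplings μ ν, ∀ Q ∈ couplings μ ν,
    eLpNorm (fun z => dF P z - dF Q z) ∞ ((μ : Measure X).prod (ν : Measure Y)) ≤ L * W1 P Q

/-- The inner objective `π ↦ ∫ φ dπ + H(π ‖ R)`, with values in `(-∞, ∞]` for bounded
measurable `φ`. -/
def innerObjective (R : ProbabilityMeasure (X × Y)) (φ : X × Y → ℝ)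
    (π : ProbabilityMeasure (X × Y)) : EReal :=
  ((∫ z, φ z ∂(π : Measure (X × Y)) : ℝ) : EReal) +
    ((InformationTheory.klDiv (π : Measure (X × Y)) (R : Measure (X × Y)) : ℝ≥0∞) : EReal)

/-- The set of minimizers over `Π(μ, ν)` of the inner objective with potential `φ`. -/
def innerArgmin (μ : ProbabilityMeasure X) (ν : ProbabilityMeasure Y)
    (R : ProbabilityMeasure (X × Y)) (φ : X × Y → ℝ) : Set (couplings μ ν) :=
  {π | ∀ π' : couplings μ ν, innerObjective R φ π ≤ innerObjective R φ π'}

end Problem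

end EntropicOT

end

/-! Everything rests on strong convexity of the entropy in total variation. Write `D` for the
`L¹(R)` distance between the densities of `P` and `Q`. At the midpoint of `P` and `Q` the objective
is below the average of its end values by at least `D ^ 2 / 24` (`toReal_klDiv_midpoint_le`,
obtained by integrating `klFun_midpoint_gap`), the linear term contributing nothing.

Existence: the gap makes a minimizing sequence Cauchy in `L¹(R)`, so completeness replaces
compactness. Fatou's lemma gives lower semicontinuity of the entropy, and the marginals survive
setwise limits (`exists_isMin_realObjective`).

Stability: adding the gap inequalities for the minimizers of two potentials cancels the entropies
and leaves `D ^ 2 / 6 ≤ ∫ (φ - ψ) d(Q - P) ≤ ε * D`, so `D ≤ 6 * ε` (`densityDist_le_of_isMin`); `ε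
= 0` is uniqueness. Since `W1` is at most the diameter bound times `D` (`W1_le_densityDist`), the
constant is `C = 6 * d`. -/

namespace EntropicOT
open InformationTheory

/-! ### Quantitative convexity of `klFun` -/

/-- The midpoint convexity gap of `klFun` dominates a multiple of `(a - b) ^ 2 / (a + b)`. -/
lemma klFun_midpoint_gap_of_le {a b : ℝ} (hb : 0 ≤ b) (hab : b < a) :
    klFun ((a + b) / 2) + (a - b) ^ 2 / (12 * (a + b)) ≤ (klFun a + klFun b) / 2 := by
  have ha : 0 < a := hb.trans_lt hab
  set c := (a + b) / 2 with hc
  have hc0 : 0 < c := by positivity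
  -- Using `1 - 1 / x ≤ log x` at both points would give a total of `0`; the gain comes from the
  -- sharper bound `2 * x / (x + 2) ≤ log (1 + x)` at the larger point.
  have h1 : 2 * a * (a - c) / (a + c) ≤ a * (Real.log a - Real.log c) := by
    have h := Real.le_log_one_add_of_nonneg (x := (a - c) / c)
      (div_nonneg (by linarith) hc0.le)
    have e : 1 + (a - c) / c = a / c := by field_simp; ring
    rw [e, Real.log_div ha.ne' hc0.ne'] at h
    have h2 := mul_le_mul_of_nonneg_left h ha.le
    refine le_trans (le_of_eq ?_) h2
    have : (a - c) / c + 2 ≠ 0 := by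
      have : 0 ≤ (a - c) / c := div_nonneg (by linarith) hc0.le
      linarith
    have h3 : a - c + 2 * c ≠ 0 := by linarith
    have h4 : a + c ≠ 0 := by positivity
    field_simp
    ring
  have h2 : b - c ≤ b * (Real.log b - Real.log c) := by
    rcases hb.eq_or_lt with rfl | hb'
    · simp; exact hc0.le
    · have h := Real.one_sub_inv_le_log_of_pos (x := b / c) (by positivity)
      rw [Real.log_div hb'.ne' hc0.ne'] at h
      have h2 := mul_le_mul_of_nonneg_left h hb
      refine le_trans (le_of_eq ?_) h2
      field_simp
  have h3 : (a - b) ^ 2 / (6 * (a + b)) ≤ 2 * a * (a - c) / (a + c) + (b - c) := by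
    have e : 2 * a * (a - c) / (a + c) + (b - c) = (a - c) ^ 2 / (a + c) := by
      have h4 : a + c ≠ 0 := by positivity
      have : b = 2 * c - a := by rw [hc]; ring
      rw [this]
      field_simp
      ring
    have e2 : (a - b) ^ 2 / (6 * (a + b)) = (a - c) ^ 2 / (3 * c) := by
      have : b = 2 * c - a := by rw [hc]; ring
      rw [this]
      field_simp
      ring
    -- What remains is `a + c ≤ 3 * c`, true because `a ≤ 2 * c` when `b ≥ 0`.
    rw [e, e2]
    gcongr
    linarith
  have e3 : (a - b) ^ 2 / (6 * (a + b)) = 2 * ((a - b) ^ 2 / (12 * (a + b))) := by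
    field_simp; ring
  have e4 : c * Real.log c = (a * Real.log c + b * Real.log c) / 2 := by rw [hc]; ring
  simp only [klFun]
  rw [e4]
  linarith

/-- Midpoint strong convexity of `klFun`, in a form that is linear in `|a - b|`. -/
lemma klFun_midpoint_gap {a b : ℝ} (ha : 0 ≤ a) (hb : 0 ≤ b) (t : ℝ) :
    klFun ((a + b) / 2) + (2 * t * |a - b| - t ^ 2 * (a + b)) / 12 ≤
      (klFun a + klFun b) / 2 := by
  wlog h : b ≤ a generalizing a b
  · have := this hb ha (le_of_not_ge h)
    rw [abs_sub_comm, add_comm a b, add_comm (klFun a)]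
    exact this
  rcases h.eq_or_lt with rfl | h
  · have : 0 ≤ t ^ 2 * (b + b) := by positivity
    simp only [sub_self, abs_zero, mul_zero, add_self_div_two]
    linarith
  · refine le_trans ?_ (klFun_midpoint_gap_of_le hb h)
    have hs : 0 < a + b := by linarith
    -- Expand `(|a - b| - t * (a + b)) ^ 2 ≥ 0`. A constant `t` can be chosen after integration,
    -- which does the work of Cauchy–Schwarz.
    have : 2 * t * |a - b| - t ^ 2 * (a + b) ≤ (a - b) ^ 2 / (a + b) := by
      rw [le_div_iff₀ hs, ← sq_abs (a - b)]
      nlinarith [sq_nonneg (|a - b| - t * (a + b))]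
    have e : (a - b) ^ 2 / (12 * (a + b)) = (a - b) ^ 2 / (a + b) / 12 := by
      field_simp
    rw [e]
    linarith

end EntropicOT

namespace EntropicOT
open InformationTheory

/-! ### Densities and strong convexity of the entropy -/

section Density

variable {Z : Type*} [MeasurableSpace Z]

/-- The density of `P` with respect to `R`, as a real-valued function. -/
noncomputable def density (R P : ProbabilityMeasure Z) (z : Z) : ℝ :=
  ((P : Measure Z).rnDeriv (R : Measure Z) z).toReal

/-- The `L¹(R)` distance between the densities of two probability measures. -/
noncomputable def densityDist (R P Q : ProbabilityMeasure Z) : ℝ :=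
  ∫ z, |density R P z - density R Q z| ∂(R : Measure Z)

/-- The real-valued objective `∫ φ dP + H(P ‖ R)`, meaningful when the entropy is finite. -/
noncomputable def realObjective (R : ProbabilityMeasure Z) (φ : Z → ℝ)
    (P : ProbabilityMeasure Z) : ℝ :=
  (∫ z, φ z ∂(P : Measure Z)) + (klDiv (P : Measure Z) (R : Measure Z)).toReal

/-- The midpoint of two probability measures. -/
noncomputable def midpoint (P Q : ProbabilityMeasure Z) : ProbabilityMeasure Z :=
  mix ⟨1 / 2, by norm_num, by norm_num⟩ P Q

variable {R P Q : ProbabilityMeasure Z} {φ : Z → ℝ} {B : ℝ}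

lemma density_nonneg (z : Z) : 0 ≤ density R P z := ENNReal.toReal_nonneg

@[fun_prop]
lemma measurable_density : Measurable (density R P) := by
  unfold density; fun_prop

lemma integrable_density : Integrable (density R P) (R : Measure Z) :=
  Measure.integrable_toReal_rnDeriv

lemma integral_density (h : (P : Measure Z) ≪ R) : ∫ z, density R P z ∂(R : Measure Z) = 1 := by
  unfold density
  rw [Measure.integral_toReal_rnDeriv h]
  simp

lemma integral_mul_density (h : (P : Measure Z) ≪ R) (φ : Z → ℝ) :
    ∫ z, φ z * density R P z ∂(R : Measure Z) = ∫ z, φ z ∂(P : Measure Z) := by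
  rw [← integral_rnDeriv_smul h]
  simp [density, mul_comm]

lemma withDensity_density (h : (P : Measure Z) ≪ R) :
    (R : Measure Z).withDensity (fun z => ENNReal.ofReal (density R P z)) = P := by
  conv_rhs => rw [← Measure.withDensity_rnDeriv_eq _ _ h]
  refine withDensity_congr_ae ?_
  filter_upwards [(P : Measure Z).rnDeriv_lt_top (R : Measure Z)] with z hz
  exact ENNReal.ofReal_toReal hz.ne

lemma eq_of_density_ae_eq (hP : (P : Measure Z) ≪ R) (hQ : (Q : Measure Z) ≪ R)
    (h : density R P =ᵐ[(R : Measure Z)] density R Q) : P = Q := by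
  apply Subtype.ext
  change (P : Measure Z) = Q
  rw [← withDensity_density hP, ← withDensity_density hQ]
  refine withDensity_congr_ae ?_
  filter_upwards [h] with z hz
  rw [hz]

lemma integrable_abs_density_sub :
    Integrable (fun z => |density R P z - density R Q z|) (R : Measure Z) :=
  (integrable_density.sub integrable_density).abs

lemma densityDist_nonneg : 0 ≤ densityDist R P Q := integral_nonneg fun _ => abs_nonneg _

lemma densityDist_comm : densityDist R P Q = densityDist R Q P := by
  simp only [densityDist, abs_sub_comm]

lemma eq_of_densityDist_le_zero (hP : (P : Measure Z) ≪ R) (hQ : (Q : Measure Z) ≪ R)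
    (h : densityDist R P Q ≤ 0) : P = Q := by
  refine eq_of_density_ae_eq hP hQ ?_
  have h0 := le_antisymm h densityDist_nonneg
  rw [densityDist, integral_eq_zero_iff_of_nonneg (fun _ => abs_nonneg _)
    integrable_abs_density_sub] at h0
  filter_upwards [h0] with z hz
  exact sub_eq_zero.1 (abs_eq_zero.1 hz)

lemma ac_of_klDiv_ne_top (h : klDiv (P : Measure Z) (R : Measure Z) ≠ ∞) :
    (P : Measure Z) ≪ R := (klDiv_ne_top_iff.1 h).1

lemma integrable_klFun_density (h : klDiv (P : Measure Z) (R : Measure Z) ≠ ∞) :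
    Integrable (fun z => klFun (density R P z)) (R : Measure Z) :=
  (integrable_klFun_rnDeriv_iff (klDiv_ne_top_iff.1 h).1).2 (klDiv_ne_top_iff.1 h).2

lemma klDiv_ne_top_of_integrable (h : (P : Measure Z) ≪ R)
    (hi : Integrable (fun z => klFun (density R P z)) (R : Measure Z)) :
    klDiv (P : Measure Z) (R : Measure Z) ≠ ∞ :=
  klDiv_ne_top h ((integrable_klFun_rnDeriv_iff h).1 hi)

lemma toReal_klDiv_eq_integral_density (h : (P : Measure Z) ≪ R) :
    (klDiv (P : Measure Z) (R : Measure Z)).toReal =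
      ∫ z, klFun (density R P z) ∂(R : Measure Z) :=
  toReal_klDiv_eq_integral_klFun h

lemma coe_midpoint : (midpoint P Q : Measure Z) =
    (2⁻¹ : ℝ≥0) • (P : Measure Z) + (2⁻¹ : ℝ≥0) • (Q : Measure Z) := by
  have e : ENNReal.ofReal (1 - 1 / 2) = ((2⁻¹ : ℝ≥0) : ℝ≥0∞) := by
    rw [show (1 - 1 / 2 : ℝ) = ((2⁻¹ : ℝ≥0) : ℝ) by push_cast; norm_num, ENNReal.ofReal_coe_nnreal]
  have e' : ENNReal.ofReal (1 / 2) = ((2⁻¹ : ℝ≥0) : ℝ≥0∞) := by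
    rw [← e]; norm_num
  change ENNReal.ofReal (1 - 1 / 2) • (P : Measure Z) + ENNReal.ofReal (1 / 2) • (Q : Measure Z) = _
  rw [e, e']
  rfl

lemma midpoint_ac (hP : (P : Measure Z) ≪ R) (hQ : (Q : Measure Z) ≪ R) :
    (midpoint P Q : Measure Z) ≪ R := by
  rw [coe_midpoint]
  intro s hs
  simp [hP hs, hQ hs]

lemma density_midpoint : density R (midpoint P Q) =ᵐ[(R : Measure Z)]
    fun z => (density R P z + density R Q z) / 2 := by
  unfold density
  rw [coe_midpoint]
  filter_upwards [Measure.rnDeriv_add ((2⁻¹ : ℝ≥0) • (P : Measure Z)) ((2⁻¹ : ℝ≥0) • (Q : Measure Z))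
    (R : Measure Z), Measure.rnDeriv_smul_left (P : Measure Z) (R : Measure Z) 2⁻¹,
    Measure.rnDeriv_smul_left (Q : Measure Z) (R : Measure Z) 2⁻¹,
    (P : Measure Z).rnDeriv_lt_top (R : Measure Z),
    (Q : Measure Z).rnDeriv_lt_top (R : Measure Z)] with z h1 h2 h3 h4 h5
  rw [h1, Pi.add_apply, h2, h3, Pi.smul_apply, Pi.smul_apply, ENNReal.smul_def, ENNReal.smul_def,
    smul_eq_mul, smul_eq_mul, ENNReal.toReal_add (ENNReal.mul_ne_top (by simp) h4.ne)
      (ENNReal.mul_ne_top (by simp) h5.ne), ENNReal.toReal_mul, ENNReal.toReal_mul]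
  simp
  ring

lemma integrable_of_bound (hφ : Measurable φ) (hB : ∀ z, |φ z| ≤ B) (P : ProbabilityMeasure Z) :
    Integrable φ (P : Measure Z) :=
  Integrable.of_bound hφ.aestronglyMeasurable B (ae_of_all _ hB)

lemma integral_midpoint (hφ : Measurable φ) (hB : ∀ z, |φ z| ≤ B) :
    ∫ z, φ z ∂(midpoint P Q : Measure Z) =
      ((∫ z, φ z ∂(P : Measure Z)) + ∫ z, φ z ∂(Q : Measure Z)) / 2 := by
  have hP := integrable_of_bound hφ hB P
  have hQ := integrable_of_bound hφ hB Q
  rw [coe_midpoint, integral_add_measure (hP.smul_measure_nnreal) (hQ.smul_measure_nnreal),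
    integral_smul_nnreal_measure, integral_smul_nnreal_measure]
  simp only [NNReal.smul_def, smul_eq_mul]
  push_cast
  ring

lemma klDiv_midpoint_ne_top (hP : klDiv (P : Measure Z) (R : Measure Z) ≠ ∞)
    (hQ : klDiv (Q : Measure Z) (R : Measure Z) ≠ ∞) :
    klDiv (midpoint P Q : Measure Z) (R : Measure Z) ≠ ∞ := by
  refine klDiv_ne_top_of_integrable (midpoint_ac (ac_of_klDiv_ne_top hP) (ac_of_klDiv_ne_top hQ)) ?_
  refine (((integrable_klFun_density hP).add (integrable_klFun_density hQ)).div_const 2).mono'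
    (measurable_klFun.comp measurable_density).aestronglyMeasurable ?_
  filter_upwards [density_midpoint (R := R) (P := P) (Q := Q)] with z hz
  rw [Real.norm_of_nonneg (klFun_nonneg (density_nonneg z)), hz]
  -- With `t = 0` the gap lemma is plain midpoint convexity.
  simpa using klFun_midpoint_gap (density_nonneg (R := R) (P := P) z)
    (density_nonneg (R := R) (P := Q) z) 0

/-- Strong midpoint convexity of the relative entropy for the total variation distance. -/
lemma toReal_klDiv_midpoint_le (hP : klDiv (P : Measure Z) (R : Measure Z) ≠ ∞)
    (hQ : klDiv (Q : Measure Z) (R : Measure Z) ≠ ∞) :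
    (klDiv (midpoint P Q : Measure Z) (R : Measure Z)).toReal + densityDist R P Q ^ 2 / 24 ≤
      ((klDiv (P : Measure Z) (R : Measure Z)).toReal +
        (klDiv (Q : Measure Z) (R : Measure Z)).toReal) / 2 := by
  have aP := ac_of_klDiv_ne_top hP
  have aQ := ac_of_klDiv_ne_top hQ
  rw [toReal_klDiv_eq_integral_density aP, toReal_klDiv_eq_integral_density aQ,
    toReal_klDiv_eq_integral_density (midpoint_ac aP aQ)]
  -- The densities have total mass `2`, so this `t` maximizes `2 * t * D - 2 * t ^ 2`, with value `D
  -- ^ 2 / 2`.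
  set t := densityDist R P Q / 2 with ht
  have i1 := integrable_klFun_density (klDiv_midpoint_ne_top hP hQ)
  have i2 : Integrable (fun z => (2 * t * |density R P z - density R Q z| -
      t ^ 2 * (density R P z + density R Q z)) / 12) (R : Measure Z) :=
    ((integrable_abs_density_sub.const_mul _).sub
      ((integrable_density.add integrable_density).const_mul _)).div_const 12
  have i3 : Integrable (fun z => t ^ 2 * (density R P z + density R Q z)) (R : Measure Z) :=
    (integrable_density.add integrable_density).const_mul _
  have key : ∫ z, (klFun (density R (midpoint P Q) z) +
      (2 * t * |density R P z - density R Q z| -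
        t ^ 2 * (density R P z + density R Q z)) / 12) ∂(R : Measure Z) ≤
      ∫ z, (klFun (density R P z) + klFun (density R Q z)) / 2 ∂(R : Measure Z) := by
    refine integral_mono_ae (i1.add i2)
      (((integrable_klFun_density hP).add (integrable_klFun_density hQ)).div_const 2) ?_
    filter_upwards [density_midpoint (R := R) (P := P) (Q := Q)] with z hz
    rw [hz]
    exact klFun_midpoint_gap (density_nonneg z) (density_nonneg z) t
  rw [integral_add i1 i2, integral_div, integral_div,
    integral_add (integrable_klFun_density hP) (integrable_klFun_density hQ),
    integral_sub (integrable_abs_density_sub.const_mul _) i3, integral_const_mul,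
    integral_const_mul, integral_add integrable_density integrable_density, integral_density aP,
    integral_density aQ] at key
  change _ + (2 * t * densityDist R P Q - t ^ 2 * (1 + 1)) / 12 ≤ _ at key
  refine le_trans (le_of_eq ?_) key
  rw [ht]
  ring

lemma realObjective_midpoint_le (hφ : Measurable φ) (hB : ∀ z, |φ z| ≤ B)
    (hP : klDiv (P : Measure Z) (R : Measure Z) ≠ ∞)
    (hQ : klDiv (Q : Measure Z) (R : Measure Z) ≠ ∞) :
    realObjective R φ (midpoint P Q) + densityDist R P Q ^ 2 / 24 ≤
      (realObjective R φ P + realObjective R φ Q) / 2 := by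
  have := toReal_klDiv_midpoint_le hP hQ
  simp only [realObjective, integral_midpoint hφ hB]
  linarith

lemma neg_le_realObjective (hB : ∀ z, |φ z| ≤ B) (P : ProbabilityMeasure Z) :
    -B ≤ realObjective R φ P := by
  have h : ‖∫ z, φ z ∂(P : Measure Z)‖ ≤ B * (P : Measure Z).real Set.univ :=
    norm_integral_le_of_norm_le_const (ae_of_all _ hB)
  rw [probReal_univ, mul_one, Real.norm_eq_abs] at h
  have := (abs_le.1 h).1
  have h2 : 0 ≤ (klDiv (P : Measure Z) (R : Measure Z)).toReal := ENNReal.toReal_nonneg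
  unfold realObjective
  linarith

/-- `L¹`–`L^∞` duality. The bound on `φ` is needed only `R`-a.e., which is what an essential
supremum can supply. -/
lemma integral_sub_integral_le {ε : ℝ} (hφ : Measurable φ)
    (hε : ∀ᵐ z ∂(R : Measure Z), |φ z| ≤ ε) (aP : (P : Measure Z) ≪ R)
    (aQ : (Q : Measure Z) ≪ R) :
    (∫ z, φ z ∂(P : Measure Z)) - ∫ z, φ z ∂(Q : Measure Z) ≤ ε * densityDist R P Q := by
  have ib : ∀ P' : ProbabilityMeasure Z,
      Integrable (fun z => φ z * density R P' z) (R : Measure Z) := fun P' =>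
    integrable_density.bdd_mul hφ.aestronglyMeasurable hε
  rw [← integral_mul_density aQ, ← integral_mul_density aP, ← integral_sub (ib P) (ib Q),
    densityDist, ← integral_const_mul]
  refine integral_mono_ae ((ib P).sub (ib Q)) (integrable_abs_density_sub.const_mul _) ?_
  filter_upwards [hε] with z hz
  rw [← mul_sub]
  refine (le_abs_self _).trans ?_
  rw [abs_mul]
  gcongr

lemma abs_integral_sub_integral_le {ε : ℝ} (hφ : Measurable φ)
    (hε : ∀ᵐ z ∂(R : Measure Z), |φ z| ≤ ε) (aP : (P : Measure Z) ≪ R)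
    (aQ : (Q : Measure Z) ≪ R) :
    |(∫ z, φ z ∂(P : Measure Z)) - ∫ z, φ z ∂(Q : Measure Z)| ≤ ε * densityDist R P Q := by
  have h := integral_sub_integral_le hφ hε aQ aP
  rw [densityDist_comm] at h
  exact abs_sub_le_iff.2 ⟨integral_sub_integral_le hφ hε aP aQ, h⟩

/-- Two potentials that are `ε`-close `R`-almost everywhere have minimizers whose densities are
`6 ε`-close in `L¹(R)`. -/
lemma densityDist_le_of_isMin {φ ψ : Z → ℝ} {B' ε : ℝ} (hφ : Measurable φ) (hB : ∀ z, |φ z| ≤ B)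
    (hψ : Measurable ψ) (hB' : ∀ z, |ψ z| ≤ B')
    (hε : ∀ᵐ z ∂(R : Measure Z), |φ z - ψ z| ≤ ε)
    (hP : klDiv (P : Measure Z) (R : Measure Z) ≠ ∞)
    (hQ : klDiv (Q : Measure Z) (R : Measure Z) ≠ ∞)
    (hPm : realObjective R φ P ≤ realObjective R φ (midpoint P Q))
    (hQm : realObjective R ψ Q ≤ realObjective R ψ (midpoint P Q)) :
    densityDist R P Q ≤ 6 * ε := by
  have aP := ac_of_klDiv_ne_top hP
  have aQ := ac_of_klDiv_ne_top hQ
  have h1 := realObjective_midpoint_le hφ hB hP hQ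
  have h2 := realObjective_midpoint_le hψ hB' hP hQ
  -- Minimality turns each gap inequality into `D ^ 2 / 12 ≤` a difference of objectives; in the sum
  -- the entropies cancel.
  have h3 : densityDist R P Q ^ 2 / 6 ≤
      ((∫ z, φ z ∂(Q : Measure Z)) - ∫ z, ψ z ∂(Q : Measure Z)) -
      ((∫ z, φ z ∂(P : Measure Z)) - ∫ z, ψ z ∂(P : Measure Z)) := by
    simp only [realObjective] at *
    linarith
  have h4 := integral_sub_integral_le (hφ.sub hψ) hε aQ aP
  simp only [Pi.sub_apply] at h4
  rw [integral_sub (integrable_of_bound hφ hB Q) (integrable_of_bound hψ hB' Q),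
    integral_sub (integrable_of_bound hφ hB P) (integrable_of_bound hψ hB' P),
    densityDist_comm] at h4
  have hD : 0 ≤ densityDist R P Q := densityDist_nonneg
  rcases hD.eq_or_lt with h0 | h0
  · rw [← h0]
    -- When `D = 0` only `0 ≤ ε` is needed; any point where the a.e. bound holds shows it.
    obtain ⟨z, hz⟩ := hε.exists
    have := (abs_nonneg _).trans hz
    positivity
  · have : densityDist R P Q * densityDist R P Q ≤ 6 * ε * densityDist R P Q := by nlinarith
    exact le_of_mul_le_mul_right this h0

end Density

end EntropicOT

namespace EntropicOT
open InformationTheory Filter Topology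

/-! ### Existence of minimizers by completeness of `L¹(R)` -/

section Existence

variable {Z : Type*} [MeasurableSpace Z] {R P Q : ProbabilityMeasure Z} {φ : Z → ℝ} {B : ℝ}

/-- The density of `P` with respect to `R` as an element of `L¹(R)`. -/
noncomputable def densityL1 (R P : ProbabilityMeasure Z) : Z →₁[(R : Measure Z)] ℝ :=
  (integrable_density (R := R) (P := P)).toL1 (density R P)

lemma densityL1_ae_eq : densityL1 R P =ᵐ[(R : Measure Z)] density R P :=
  Integrable.coeFn_toL1 _

lemma dist_densityL1 : dist (densityL1 R P) (densityL1 R Q) = densityDist R P Q := by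
  rw [L1.dist_eq_integral_dist, densityDist]
  refine integral_congr_ae ?_
  filter_upwards [densityL1_ae_eq (R := R) (P := P), densityL1_ae_eq (R := R) (P := Q)] with z h1 h2
  rw [h1, h2, Real.dist_eq]

lemma exists_tendsto_density_ae {u : ℕ → ProbabilityMeasure Z} {g : Z →₁[(R : Measure Z)] ℝ}
    (h : Tendsto (fun n => densityL1 R (u n)) atTop (𝓝 g)) :
    ∃ ns : ℕ → ℕ, StrictMono ns ∧ ∀ᵐ z ∂(R : Measure Z),
      Tendsto (fun i => density R (u (ns i)) z) atTop (𝓝 (g z)) := by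
  obtain ⟨ns, hns, h2⟩ := (tendstoInMeasure_of_tendsto_Lp h).exists_seq_tendsto_ae
  refine ⟨ns, hns, ?_⟩
  have h3 : ∀ᵐ z ∂(R : Measure Z), ∀ i, densityL1 R (u (ns i)) z = density R (u (ns i)) z :=
    ae_all_iff.2 fun i => densityL1_ae_eq
  filter_upwards [h2, h3] with z hz hz'
  simpa only [hz'] using hz

/-- Probability densities are closed in `L¹(R)`. -/
lemma exists_eq_densityL1 {u : ℕ → ProbabilityMeasure Z} (hu : ∀ n, (u n : Measure Z) ≪ R)
    {g : Z →₁[(R : Measure Z)] ℝ} (h : Tendsto (fun n => densityL1 R (u n)) atTop (𝓝 g)) :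
    ∃ P : ProbabilityMeasure Z, (P : Measure Z) ≪ R ∧ densityL1 R P = g := by
  have gi : Integrable g (R : Measure Z) := L1.integrable_coeFn g
  have g0 : 0 ≤ᵐ[(R : Measure Z)] g := by
    obtain ⟨ns, -, h2⟩ := exists_tendsto_density_ae h
    filter_upwards [h2] with z hz
    exact ge_of_tendsto' hz fun i => density_nonneg z
  have g1 : ∫ z, g z ∂(R : Measure Z) = 1 := by
    have h3 := ((continuous_integral (μ := (R : Measure Z)) (G := ℝ)).tendsto g).comp h
    refine tendsto_nhds_unique h3 (tendsto_const_nhds.congr fun n => ?_)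
    exact ((integral_congr_ae densityL1_ae_eq).trans (integral_density (hu n))).symm
  have gm : AEMeasurable (fun z => ENNReal.ofReal (g z)) (R : Measure Z) :=
    gi.aestronglyMeasurable.aemeasurable.ennreal_ofReal
  have hp : IsProbabilityMeasure ((R : Measure Z).withDensity fun z => ENNReal.ofReal (g z)) := by
    constructor
    rw [withDensity_apply _ MeasurableSet.univ, Measure.restrict_univ,
      ← ofReal_integral_eq_lintegral_ofReal gi g0, g1, ENNReal.ofReal_one]
  refine ⟨⟨_, hp⟩, withDensity_absolutelyContinuous _ _, ?_⟩
  apply Lp.ext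
  refine densityL1_ae_eq.trans ?_
  filter_upwards [Measure.rnDeriv_withDensity₀ (R : Measure Z) gm, g0] with z hz hz0
  unfold density
  change (Measure.rnDeriv ((R : Measure Z).withDensity fun z => ENNReal.ofReal (g z)) _ z).toReal = _
  rw [hz, ENNReal.toReal_ofReal hz0]

/-- Sublevel sets of the objective are closed for `L¹(R)` convergence of densities. -/
lemma realObjective_le_of_tendsto (hφ : Measurable φ) (hB : ∀ z, |φ z| ≤ B)
    {u : ℕ → ProbabilityMeasure Z} (hu : ∀ n, klDiv (u n : Measure Z) (R : Measure Z) ≠ ∞)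
    (aP : (P : Measure Z) ≪ R)
    (h : Tendsto (fun n => densityL1 R (u n)) atTop (𝓝 (densityL1 R P))) {m : ℝ}
    (hm : Tendsto (fun n => realObjective R φ (u n)) atTop (𝓝 m)) :
    klDiv (P : Measure Z) (R : Measure Z) ≠ ∞ ∧ realObjective R φ P ≤ m := by
  have hint : Tendsto (fun n => ∫ z, φ z ∂(u n : Measure Z)) atTop
      (𝓝 (∫ z, φ z ∂(P : Measure Z))) := by
    rw [tendsto_iff_dist_tendsto_zero] at h ⊢
    refine squeeze_zero (fun _ => dist_nonneg) (fun n => ?_) (by simpa using h.const_mul B)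
    rw [dist_densityL1]
    exact abs_integral_sub_integral_le hφ (ae_of_all _ hB) (ac_of_klDiv_ne_top (hu n)) aP
  -- Objective and linear term both converge, so the entropies do too, and a.e. convergence along a
  -- subsequence suffices for Fatou below.
  have hkl : Tendsto (fun n => (klDiv (u n : Measure Z) (R : Measure Z)).toReal) atTop
      (𝓝 (m - ∫ z, φ z ∂(P : Measure Z))) := by
    refine (hm.sub hint).congr fun n => ?_
    simp [realObjective]
  have hkl0 : 0 ≤ m - ∫ z, φ z ∂(P : Measure Z) :=
    ge_of_tendsto' hkl fun n => ENNReal.toReal_nonneg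
  obtain ⟨ns, hns, hae⟩ := exists_tendsto_density_ae h
  have hle : klDiv (P : Measure Z) (R : Measure Z) ≤
      ENNReal.ofReal (m - ∫ z, φ z ∂(P : Measure Z)) := by
    have hlim : Tendsto (fun i => klDiv (u (ns i) : Measure Z) (R : Measure Z)) atTop
        (𝓝 (ENNReal.ofReal (m - ∫ z, φ z ∂(P : Measure Z)))) := by
      refine (ENNReal.tendsto_ofReal (hkl.comp hns.tendsto_atTop)).congr fun i => ?_
      exact ENNReal.ofReal_toReal (hu _)
    rw [← hlim.liminf_eq, klDiv_eq_lintegral_klFun_of_ac aP]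
    calc ∫⁻ z, ENNReal.ofReal (klFun (density R P z)) ∂(R : Measure Z)
        = ∫⁻ z, liminf (fun i => ENNReal.ofReal (klFun (density R (u (ns i)) z))) atTop
            ∂(R : Measure Z) := by
          refine lintegral_congr_ae ?_
          filter_upwards [hae, densityL1_ae_eq (R := R) (P := P)] with z hz hz'
          rw [hz'] at hz
          exact (ENNReal.tendsto_ofReal
            ((continuous_klFun.tendsto _).comp hz)).liminf_eq.symm
      _ ≤ liminf (fun i => ∫⁻ z, ENNReal.ofReal (klFun (density R (u (ns i)) z))
            ∂(R : Measure Z)) atTop :=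
          lintegral_liminf_le fun i =>
            (measurable_klFun.comp measurable_density).ennreal_ofReal
      _ = _ := by
          congr 1
          ext i
          exact (klDiv_eq_lintegral_klFun_of_ac (ac_of_klDiv_ne_top (hu _))).symm
  refine ⟨ne_top_of_le_ne_top ENNReal.ofReal_ne_top hle, ?_⟩
  have := ENNReal.toReal_mono ENNReal.ofReal_ne_top hle
  rw [ENNReal.toReal_ofReal hkl0] at this
  unfold realObjective
  linarith

/-- Existence of a minimizer over a set that is stable under midpoints and setwise limits. -/
lemma exists_isMin_realObjective (hφ : Measurable φ) (hB : ∀ z, |φ z| ≤ B)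
    {S : Set (ProbabilityMeasure Z)} (hmid : ∀ P ∈ S, ∀ Q ∈ S, midpoint P Q ∈ S)
    (hclosed : ∀ (u : ℕ → ProbabilityMeasure Z) (P : ProbabilityMeasure Z), (∀ n, u n ∈ S) →
      (∀ s, MeasurableSet s → Tendsto (fun n => (u n : Measure Z).real s) atTop
        (𝓝 ((P : Measure Z).real s))) → P ∈ S)
    (hne : ∃ P ∈ S, klDiv (P : Measure Z) (R : Measure Z) ≠ ∞) :
    ∃ P ∈ S, klDiv (P : Measure Z) (R : Measure Z) ≠ ∞ ∧
      ∀ Q ∈ S, klDiv (Q : Measure Z) (R : Measure Z) ≠ ∞ →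
        realObjective R φ P ≤ realObjective R φ Q := by
  set V : Set ℝ := realObjective R φ '' {P | P ∈ S ∧ klDiv (P : Measure Z) (R : Measure Z) ≠ ∞}
    with hV
  have Vne : V.Nonempty := by
    obtain ⟨P, hP, hP'⟩ := hne
    exact ⟨_, P, ⟨hP, hP'⟩, rfl⟩
  have Vbdd : BddBelow V := ⟨-B, by rintro _ ⟨P, -, rfl⟩; exact neg_le_realObjective hB P⟩
  obtain ⟨v, -, hv, hvV⟩ := exists_seq_tendsto_sInf Vne Vbdd
  choose u hu huv using hvV
  have hlow : ∀ Q ∈ S, klDiv (Q : Measure Z) (R : Measure Z) ≠ ∞ →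
      sInf V ≤ realObjective R φ Q := fun Q hQ hQ' => csInf_le Vbdd ⟨Q, ⟨hQ, hQ'⟩, rfl⟩
  -- The midpoint is again a competitor, so its objective is at least `sInf V`; hence `D ^ 2 / 24`
  -- is at most the average excess of the two terms over `sInf V`.
  have hcauchy : CauchySeq fun n => densityL1 R (u n) := by
    rw [Metric.cauchySeq_iff]
    intro ε hε
    have hev : ∀ᶠ n in atTop, v n < sInf V + ε ^ 2 / 24 :=
      hv.eventually_lt_const (by have : 0 < ε ^ 2 := by positivity
                                 linarith)
    obtain ⟨N, hN⟩ := eventually_atTop.1 hev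
    refine ⟨N, fun i hi j hj => ?_⟩
    rw [dist_densityL1]
    have h1 := realObjective_midpoint_le hφ hB (hu i).2 (hu j).2
    have h2 := hlow _ (hmid _ (hu i).1 _ (hu j).1) (klDiv_midpoint_ne_top (hu i).2 (hu j).2)
    rw [huv, huv] at h1
    have h3 := hN i hi
    have h4 := hN j hj
    exact lt_of_pow_lt_pow_left₀ 2 hε.le (by linarith)
  obtain ⟨g, hg⟩ := cauchySeq_tendsto_of_complete hcauchy
  have au : ∀ n, (u n : Measure Z) ≪ R := fun n => ac_of_klDiv_ne_top (hu n).2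
  obtain ⟨P, aP, rfl⟩ := exists_eq_densityL1 au hg
  obtain ⟨hP, hle⟩ := realObjective_le_of_tendsto hφ hB (fun n => (hu n).2) aP hg
    (hv.congr fun n => (huv n).symm)
  refine ⟨P, hclosed u P (fun n => (hu n).1) fun s hs => ?_, hP,
    fun Q hQ hQ' => hle.trans (hlow Q hQ hQ')⟩
  rw [tendsto_iff_dist_tendsto_zero] at hg ⊢
  refine squeeze_zero (fun _ => dist_nonneg) (fun n => ?_) hg
  rw [dist_densityL1, Real.dist_eq, ← integral_indicator_one hs, ← integral_indicator_one hs]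
  -- Duality with an indicator: `L¹(R)` convergence implies setwise convergence.
  refine (abs_integral_sub_integral_le (measurable_one.indicator hs) (ε := 1)
    (ae_of_all _ fun z => ?_) (au n) aP).trans (one_mul _).le
  by_cases hz : z ∈ s <;> simp [hz]

end Existence

/-! ### Wasserstein distance against total variation -/

section Wasserstein

variable {Z : Type*} [MetricSpace Z] [MeasurableSpace Z] {R P Q : ProbabilityMeasure Z}

/-- If `P` and `Q` share the common part `M`, then `W₁(P, Q)` is at most the diameter times the
mass of the remainder. -/
lemma W1_le_of_common_part {d : ℝ≥0∞} (hd : ∀ x y : Z, edist x y ≤ d) {M A A' : Measure Z}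
    (hP : (P : Measure Z) = M + A) (hQ : (Q : Measure Z) = M + A') :
    W1 P Q ≤ d * A Set.univ := by
  have hP1 : M Set.univ + A Set.univ = 1 := by
    rw [← Measure.add_apply, ← hP, measure_univ]
  have hQ1 : M Set.univ + A' Set.univ = 1 := by
    rw [← Measure.add_apply, ← hQ, measure_univ]
  have hM : M Set.univ ≠ ∞ := ne_top_of_le_ne_top ENNReal.one_ne_top (hP1 ▸ le_self_add)
  have hA : A Set.univ ≠ ∞ := ne_top_of_le_ne_top ENNReal.one_ne_top (hP1 ▸ le_add_self)
  have hAA : A' Set.univ = A Set.univ := (ENNReal.add_right_inj hM).1 (hQ1.trans hP1.symm)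
  have : IsFiniteMeasure A := ⟨hA.lt_top⟩
  have : IsFiniteMeasure A' := ⟨hAA ▸ hA.lt_top⟩
  set δ := A Set.univ with hδ
  -- Covers `δ = 0` too: there `δ⁻¹ = ∞`, but `N` vanishes and `∞ * 0 = 0`.
  have hcancel : ∀ (N : Measure Z), N Set.univ = δ → ∀ s, δ⁻¹ * (N s * δ) = N s := by
    intro N hN s
    rcases eq_or_ne δ 0 with h0 | h0
    · have : N s = 0 := measure_mono_null (Set.subset_univ s) (hN.trans h0)
      simp [this]
    · rw [mul_comm (N s), ← mul_assoc, ENNReal.inv_mul_cancel h0 hA, one_mul]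
  have hdiag : Measurable fun z : Z => (z, z) := measurable_id.prodMk measurable_id
  -- Leave `M` in place on the diagonal, at no cost, and couple the remainders independently; `δ⁻¹`
  -- restores the mass.
  set γ : Measure (Z × Z) := M.map (fun z => (z, z)) + δ⁻¹ • A.prod A' with hγ
  have hfst : γ.fst = P := by
    ext s hs
    rw [Measure.fst_apply hs, hP, hγ, Measure.add_apply, Measure.add_apply,
      Measure.map_apply hdiag (measurable_fst hs), Measure.smul_apply, ← Set.prod_univ,
      Measure.prod_prod, hAA, smul_eq_mul, hcancel A rfl]
    simp [Set.mk_preimage_prod]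
  have hsnd : γ.snd = Q := by
    ext s hs
    rw [Measure.snd_apply hs, hQ, hγ, Measure.add_apply, Measure.add_apply,
      Measure.map_apply hdiag (measurable_snd hs), Measure.smul_apply, ← Set.univ_prod,
      Measure.prod_prod, ← hδ, smul_eq_mul, mul_comm δ, hcancel A' hAA]
    simp [Set.mk_preimage_prod]
  have hγp : IsProbabilityMeasure γ := by
    constructor
    rw [← Measure.fst_univ, hfst, measure_univ]
  refine (iInf₂_le (⟨γ, hγp⟩ : ProbabilityMeasure (Z × Z)) ⟨hfst, hsnd⟩).trans ?_
  change ∫⁻ p : Z × Z, edist p.1 p.2 ∂γ ≤ _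
  rw [hγ, lintegral_add_measure, lintegral_smul_measure]
  have h1 : ∫⁻ p : Z × Z, edist p.1 p.2 ∂(M.map fun z => (z, z)) = 0 :=
    le_antisymm ((lintegral_map_le _ _).trans (by simp)) zero_le
  have h2 : ∫⁻ p : Z × Z, edist p.1 p.2 ∂(A.prod A') ≤ d * (δ * δ) := by
    refine (lintegral_mono fun p : Z × Z => hd p.1 p.2).trans ?_
    rw [lintegral_const, ← Set.univ_prod_univ, Measure.prod_prod, hAA]
  rw [h1, zero_add, smul_eq_mul]
  calc δ⁻¹ * ∫⁻ p : Z × Z, edist p.1 p.2 ∂(A.prod A') ≤ δ⁻¹ * (d * (δ * δ)) := by gcongr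
    _ = d * (δ⁻¹ * (A Set.univ * δ)) := by rw [← hδ]; ring
    _ = d * δ := by rw [hcancel A rfl]

/-- The Wasserstein distance is controlled by the diameter times the total variation distance. -/
lemma W1_le_densityDist {d : ℝ≥0∞} (hd : ∀ x y : Z, edist x y ≤ d) (aP : (P : Measure Z) ≪ R)
    (aQ : (Q : Measure Z) ≪ R) : W1 P Q ≤ d * ENNReal.ofReal (densityDist R P Q) := by
  have hm : Measurable fun z => ENNReal.ofReal (min (density R P z) (density R Q z)) := by fun_prop
  -- The common part is the measure whose density is the pointwise minimum.
  have split : ∀ P' : ProbabilityMeasure Z, (P' : Measure Z) ≪ R →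
      (∀ z, min (density R P z) (density R Q z) ≤ density R P' z) → (P' : Measure Z) =
      (R : Measure Z).withDensity (fun z => ENNReal.ofReal (min (density R P z) (density R Q z))) +
      (R : Measure Z).withDensity
        (fun z => ENNReal.ofReal (density R P' z - min (density R P z) (density R Q z))) := by
    intro P' aP' hle
    rw [← withDensity_add_left hm]
    conv_lhs => rw [← withDensity_density aP']
    congr 1
    ext z
    rw [Pi.add_apply, ← ENNReal.ofReal_add (le_min (density_nonneg z) (density_nonneg z))
      (sub_nonneg.2 (hle z)), add_sub_cancel]
  refine (W1_le_of_common_part hd (split P aP fun z => min_le_left _ _)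
    (split Q aQ fun z => min_le_right _ _)).trans ?_
  gcongr
  rw [withDensity_apply _ MeasurableSet.univ, Measure.restrict_univ, densityDist,
    ofReal_integral_eq_lintegral_ofReal integrable_abs_density_sub
      (ae_of_all _ fun _ => abs_nonneg _)]
  refine lintegral_mono fun z => ENNReal.ofReal_le_ofReal ?_
  rcases le_total (density R P z) (density R Q z) with h | h
  · simp [h]
  · rw [min_eq_right h]
    exact le_abs_self _

end Wasserstein

end EntropicOT

namespace EntropicOT
open InformationTheory Filter Topology

/-! ### Stability of the coupling set -/

section Couplings

variable {α β : Type*} [MeasurableSpace α] [MeasurableSpace β] {ρ : ProbabilityMeasure α}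
  {η : ProbabilityMeasure β}

lemma midpoint_mem_couplings {P Q : ProbabilityMeasure (α × β)} (hP : P ∈ couplings ρ η)
    (hQ : Q ∈ couplings ρ η) : midpoint P Q ∈ couplings ρ η := by
  have half : ∀ a : ℝ≥0∞, ((2⁻¹ : ℝ≥0) : ℝ≥0∞) * a + ((2⁻¹ : ℝ≥0) : ℝ≥0∞) * a = a := by
    intro a
    rw [← add_mul, ← ENNReal.coe_add]
    norm_num
  constructor
  · ext s hs
    rw [Measure.fst_apply hs, coe_midpoint, Measure.add_apply, Measure.smul_apply,
      Measure.smul_apply, ← Measure.fst_apply hs, ← Measure.fst_apply hs, hP.1, hQ.1]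
    exact half _
  · ext s hs
    rw [Measure.snd_apply hs, coe_midpoint, Measure.add_apply, Measure.smul_apply,
      Measure.smul_apply, ← Measure.snd_apply hs, ← Measure.snd_apply hs, hP.2, hQ.2]
    exact half _

lemma mem_couplings_of_tendsto {u : ℕ → ProbabilityMeasure (α × β)}
    {P : ProbabilityMeasure (α × β)} (hu : ∀ n, u n ∈ couplings ρ η)
    (h : ∀ s, MeasurableSet s → Tendsto (fun n => (u n : Measure (α × β)).real s) atTop
      (𝓝 ((P : Measure (α × β)).real s))) : P ∈ couplings ρ η := by
  constructor
  · refine Measure.ext fun s hs => ?_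
    rw [← measureReal_eq_measureReal_iff]
    have e : ∀ Q : ProbabilityMeasure (α × β), (Q : Measure (α × β)).real (Prod.fst ⁻¹' s) =
        (Q : Measure (α × β)).fst.real s := fun Q => by
      rw [measureReal_def, measureReal_def, Measure.fst_apply hs]
    rw [← e]
    refine tendsto_nhds_unique (h _ (measurable_fst hs)) (tendsto_const_nhds.congr fun n => ?_)
    rw [e, (hu n).1]
  · refine Measure.ext fun s hs => ?_
    rw [← measureReal_eq_measureReal_iff]
    have e : ∀ Q : ProbabilityMeasure (α × β), (Q : Measure (α × β)).real (Prod.snd ⁻¹' s) =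
        (Q : Measure (α × β)).snd.real s := fun Q => by
      rw [measureReal_def, measureReal_def, Measure.snd_apply hs]
    rw [← e]
    refine tendsto_nhds_unique (h _ (measurable_snd hs)) (tendsto_const_nhds.congr fun n => ?_)
    rw [e, (hu n).2]

end Couplings

/-! ### The inner problem over couplings -/

section InnerProblem

variable {X Y : Type*} [MeasurableSpace X] [MeasurableSpace Y]
  {μ : ProbabilityMeasure X} {ν : ProbabilityMeasure Y} {R : ProbabilityMeasure (X × Y)}
  {φ : X × Y → ℝ} {B : ℝ}

lemma innerObjective_eq_coe {P : ProbabilityMeasure (X × Y)}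
    (hP : klDiv (P : Measure (X × Y)) (R : Measure (X × Y)) ≠ ∞) :
    innerObjective R φ P = (realObjective R φ P : EReal) := by
  rw [innerObjective, realObjective, EReal.coe_add, EReal.coe_ennreal_toReal hP]

lemma innerObjective_eq_top {P : ProbabilityMeasure (X × Y)}
    (hP : klDiv (P : Measure (X × Y)) (R : Measure (X × Y)) = ∞) :
    innerObjective R φ P = ⊤ := by
  rw [innerObjective, hP, EReal.coe_ennreal_top, EReal.coe_add_top]

/-- A feasible coupling of finite entropy rules out the value `⊤` at a minimizer, so the `EReal`
problem reduces to a real one. -/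
lemma mem_innerArgmin_iff
    (hfeas : ∃ π ∈ couplings μ ν, klDiv (π : Measure (X × Y)) (R : Measure (X × Y)) ≠ ∞)
    {P : couplings μ ν} : P ∈ innerArgmin μ ν R φ ↔
      klDiv (P : Measure (X × Y)) (R : Measure (X × Y)) ≠ ∞ ∧
      ∀ Q ∈ couplings μ ν, klDiv (Q : Measure (X × Y)) (R : Measure (X × Y)) ≠ ∞ →
        realObjective R φ P ≤ realObjective R φ Q := by
  constructor
  · intro h
    have hP : klDiv (P : Measure (X × Y)) (R : Measure (X × Y)) ≠ ∞ := by
      intro hP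
      obtain ⟨Q, hQ, hQ'⟩ := hfeas
      have h1 := h ⟨Q, hQ⟩
      rw [innerObjective_eq_top hP, innerObjective_eq_coe hQ', top_le_iff] at h1
      exact EReal.coe_ne_top _ h1
    refine ⟨hP, fun Q hQ hQ' => ?_⟩
    have h1 := h ⟨Q, hQ⟩
    rw [innerObjective_eq_coe hP, innerObjective_eq_coe hQ'] at h1
    exact EReal.coe_le_coe_iff.1 h1
  · rintro ⟨hP, h⟩ Q
    by_cases hQ : klDiv (Q : Measure (X × Y)) (R : Measure (X × Y)) = ∞
    · rw [innerObjective_eq_top hQ]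
      exact le_top
    · rw [innerObjective_eq_coe hP, innerObjective_eq_coe hQ]
      exact EReal.coe_le_coe_iff.2 (h _ Q.2 hQ)

/-- Minimizers for two `R`-a.e. `ε`-close bounded potentials have `6 ε`-close densities. -/
lemma densityDist_le_of_mem_innerArgmin
    (hfeas : ∃ π ∈ couplings μ ν, klDiv (π : Measure (X × Y)) (R : Measure (X × Y)) ≠ ∞)
    {ψ : X × Y → ℝ} {B' ε : ℝ} (hφ : Measurable φ) (hB : ∀ z, |φ z| ≤ B)
    (hψ : Measurable ψ) (hB' : ∀ z, |ψ z| ≤ B')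
    (hε : ∀ᵐ z ∂(R : Measure (X × Y)), |φ z - ψ z| ≤ ε) {P Q : couplings μ ν}
    (hP : P ∈ innerArgmin μ ν R φ) (hQ : Q ∈ innerArgmin μ ν R ψ) :
    densityDist R P Q ≤ 6 * ε := by
  rw [mem_innerArgmin_iff hfeas] at hP hQ
  have hm := midpoint_mem_couplings P.2 Q.2
  have hm' := klDiv_midpoint_ne_top hP.1 hQ.1
  exact densityDist_le_of_isMin hφ hB hψ hB' hε hP.1 hQ.1 (hP.2 _ hm hm') (hQ.2 _ hm hm')

/-- The inner problem with a bounded measurable potential has exactly one minimizer. -/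
lemma exists_innerArgmin_eq_singleton
    (hfeas : ∃ π ∈ couplings μ ν, klDiv (π : Measure (X × Y)) (R : Measure (X × Y)) ≠ ∞)
    (hφ : Measurable φ) (hB : ∀ z, |φ z| ≤ B) :
    ∃ P : couplings μ ν, innerArgmin μ ν R φ = {P} := by
  obtain ⟨P, hP, hP', hmin⟩ := exists_isMin_realObjective (R := R) hφ hB (S := couplings μ ν)
    (fun P hP Q hQ => midpoint_mem_couplings hP hQ)
    (fun u P hu h => mem_couplings_of_tendsto hu h) hfeas
  have hmem : (⟨P, hP⟩ : couplings μ ν) ∈ innerArgmin μ ν R φ :=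
    (mem_innerArgmin_iff hfeas).2 ⟨hP', hmin⟩
  refine ⟨⟨P, hP⟩, Set.eq_singleton_iff_unique_mem.2 ⟨hmem, fun Q hQ => ?_⟩⟩
  -- Uniqueness is stability for equal potentials.
  have h := densityDist_le_of_mem_innerArgmin hfeas hφ hB hφ hB (ε := 0)
    (ae_of_all _ fun z => by simp) hQ hmem
  rw [mul_zero] at h
  exact Subtype.ext (eq_of_densityDist_le_zero
    (ac_of_klDiv_ne_top ((mem_innerArgmin_iff hfeas).1 hQ).1) (ac_of_klDiv_ne_top hP') h)

end InnerProblem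

lemma exists_abs_le_of_osc {Z : Type*} [Nonempty Z] {φ : Z → ℝ} {c : ℝ}
    (h : ∀ z z', φ z - φ z' ≤ c) : ∃ B, ∀ z, |φ z| ≤ B := by
  obtain ⟨z₀⟩ := ‹Nonempty Z›
  refine ⟨|φ z₀| + c, fun z => abs_le.2 ⟨?_, ?_⟩⟩
  · linarith [h z₀ z, neg_abs_le (φ z₀)]
  · linarith [h z z₀, le_abs_self (φ z₀)]

lemma exists_edist_le (Z : Type*) [MetricSpace Z] [BoundedSpace Z] :
    ∃ d : ℝ≥0, 0 < d ∧ ∀ x y : Z, edist x y ≤ d := by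
  obtain ⟨D, hD⟩ := Metric.isBounded_iff.1 (Bornology.IsBounded.all (Set.univ : Set Z))
  refine ⟨D.toNNReal + 1, by positivity, fun x y => ?_⟩
  rw [edist_nndist, ENNReal.coe_le_coe, ← NNReal.coe_le_coe, coe_nndist]
  push_cast
  linarith [hD (Set.mem_univ x) (Set.mem_univ y), Real.le_coe_toNNReal D]

end EntropicOT

/-! ### The fixed-point map and its Lipschitz bound -/

theorem proposition3 {X Y : Type*}
    [MetricSpace X] [PolishSpace X] [BoundedSpace X] [MeasurableSpace X] [BorelSpace X]
    [MetricSpace Y] [PolishSpace Y] [BoundedSpace Y] [MeasurableSpace Y] [BorelSpace Y]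
    (μ : ProbabilityMeasure X) (ν : ProbabilityMeasure Y)
    (R : ProbabilityMeasure (X × Y))
    (hR : (R : Measure (X × Y)) ≪ (μ : Measure X).prod (ν : Measure Y))
    (hfeas : ∃ π ∈ EntropicOT.couplings μ ν,
      InformationTheory.klDiv (π : Measure (X × Y)) (R : Measure (X × Y)) ≠ ∞)
    (F : ProbabilityMeasure (X × Y) → ℝ) (dF : ProbabilityMeasure (X × Y) → X × Y → ℝ)
    (L : ℝ≥0) (hF : EntropicOT.CostAssumption μ ν F dF L) :
    ∃ T : EntropicOT.couplings μ ν → EntropicOT.couplings μ ν,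
      (∀ P : EntropicOT.couplings μ ν, EntropicOT.innerArgmin μ ν R (dF P) = {T P}) ∧
      (∃ C : ℝ≥0, 0 < C ∧ ∀ P Q : EntropicOT.couplings μ ν,
        EntropicOT.W1 (T P : ProbabilityMeasure (X × Y)) (T Q) ≤
            C * eLpNorm (fun z => dF P z - dF Q z) ∞ ((μ : Measure X).prod (ν : Measure Y)) ∧
        C * eLpNorm (fun z => dF P z - dF Q z) ∞ ((μ : Measure X).prod (ν : Measure Y)) ≤
            C * L * EntropicOT.W1 (P : ProbabilityMeasure (X × Y)) Q) ∧
      (∃ K : ℝ≥0, ∀ P Q : EntropicOT.couplings μ ν,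
        EntropicOT.W1 (T P : ProbabilityMeasure (X × Y)) (T Q) ≤
          K * EntropicOT.W1 (P : ProbabilityMeasure (X × Y)) Q) := by
  have hne : Nonempty (X × Y) := ProbabilityMeasure.nonempty R
  have hmeas : ∀ P, Measurable (dF P) := fun P =>
    (hF.deriv.continuous.comp (Continuous.prodMk_right P)).measurable
  obtain ⟨c, -, hc⟩ := hF.osc
  have hbdd : ∀ P, ∃ B, ∀ z, |dF P z| ≤ B := fun P => EntropicOT.exists_abs_le_of_osc (hc P)
  have hT : ∀ P : EntropicOT.couplings μ ν, ∃ P' : EntropicOT.couplings μ ν,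
      EntropicOT.innerArgmin μ ν R (dF P) = {P'} := fun P => by
    obtain ⟨B, hB⟩ := hbdd P
    exact EntropicOT.exists_innerArgmin_eq_singleton hfeas (hmeas P) hB
  choose T hT using hT
  obtain ⟨d, hd0, hd⟩ := EntropicOT.exists_edist_le (X × Y)
  have hmain : ∀ P Q : EntropicOT.couplings μ ν,
      EntropicOT.W1 (T P : ProbabilityMeasure (X × Y)) (T Q) ≤ (d * 6 : ℝ≥0) *
        eLpNorm (fun z => dF P z - dF Q z) ∞ ((μ : Measure X).prod (ν : Measure Y)) ∧
      (d * 6 : ℝ≥0) * eLpNorm (fun z => dF P z - dF Q z) ∞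
        ((μ : Measure X).prod (ν : Measure Y)) ≤
        (d * 6 : ℝ≥0) * L * EntropicOT.W1 (P : ProbabilityMeasure (X × Y)) Q := by
    intro P Q
    refine ⟨?_, by rw [mul_assoc]; gcongr; exact hF.lipschitz P P.2 Q Q.2⟩
    set e := eLpNorm (fun z => dF P z - dF Q z) ∞ ((μ : Measure X).prod (ν : Measure Y)) with he
    rcases eq_or_ne e ∞ with h | h
    -- Positivity of `d` matters here: `0 * ∞` would be `0`.
    · rw [h, ENNReal.mul_top (by positivity)]
      exact le_top
    have hε : ∀ᵐ z ∂(R : Measure (X × Y)), |dF P z - dF Q z| ≤ e.toReal := by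
      -- Absolute continuity carries the `μ ⊗ ν`-essential bound over to `R`.
      refine hR.ae_le ?_
      have := ae_le_eLpNormEssSup (f := fun z => dF P z - dF Q z)
        (μ := (μ : Measure X).prod (ν : Measure Y))
      rw [← eLpNorm_exponent_top, ← he] at this
      filter_upwards [this] with z hz
      simpa using ENNReal.toReal_mono h hz
    have hP : T P ∈ EntropicOT.innerArgmin μ ν R (dF P) := hT P ▸ rfl
    have hQ : T Q ∈ EntropicOT.innerArgmin μ ν R (dF Q) := hT Q ▸ rfl
    obtain ⟨B, hB⟩ := hbdd P
    obtain ⟨B', hB'⟩ := hbdd Q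
    have hD := EntropicOT.densityDist_le_of_mem_innerArgmin hfeas (hmeas P) hB (hmeas Q) hB' hε
      hP hQ
    refine (EntropicOT.W1_le_densityDist hd
      (EntropicOT.ac_of_klDiv_ne_top ((EntropicOT.mem_innerArgmin_iff hfeas).1 hP).1)
      (EntropicOT.ac_of_klDiv_ne_top ((EntropicOT.mem_innerArgmin_iff hfeas).1 hQ).1)).trans ?_
    calc (d : ℝ≥0∞) * ENNReal.ofReal (EntropicOT.densityDist R (T P) (T Q))
        ≤ d * ENNReal.ofReal (6 * e.toReal) := by gcongr
      _ = (d * 6 : ℝ≥0) * e := by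
        rw [ENNReal.ofReal_mul (by norm_num), ENNReal.ofReal_toReal h, ENNReal.coe_mul, mul_assoc]
        simp
  refine ⟨T, hT, ⟨d * 6, by positivity, hmain⟩, d * 6 * L, fun P Q => ?_⟩
  have h := (hmain P Q).1.trans (hmain P Q).2
  rwa [← ENNReal.coe_mul] at h
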